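/- Work in $\mathbb{R}^d$ with Lebesgue measure $|\cdot|$; "measurable" means Lebesgue measurable, and $Q(x,r)$ is the open axis-parallel cube of side length $r$ centred at $x$. A *property* $P$ is a $\{0,1\}$-valued function on the measurable subsets of $\mathbb{R}^d$ ($A$ has $P$ iff $P(A)=1$). Put $\bar d(A)=\limsup_{R\to\infty}|A\cap Q(0,R)|/|Q(0,R)|$ and $m(P)=\sup\{\bar d(A): P(A)=1\}$ (with $\sup\emptyset=0$), and for $\delta,\epsilon>0$ let $$\mathcal{Z}_\delta(\epsilon)A=\{x\in\mathbb{R}^d : |Q(x,\delta)\cap A|>\epsilon\,|Q(x,\delta)|\}.$$ The property $P$ is *supersaturable* if there is a function $I$ from the measurable subsets of $\mathbb{R}^d$ to $[0,\infty]$ such that (all sets being measurable): 1. $m(P)>0$; 2. if $A\supset B$, then $I(A)\ge I(B)$ and $P(A)\le P(B)$; 3. if $I(A)>0$, then $A$ does not have $P$; 4. $P(A+x)=P(A)$ and $I(A+x)=I(A)$ for every $x\in\mathbb{R}^d$; 5. there is a real number $D$ such that whenever $A_1,A_2$ are at Euclidean distance at least $D$ from each other (the empty set being at infinite distance from every set),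 $I(A_1\cup A_2)\ge I(A_1)+I(A_2)$, and $A_1\cup A_2$ has $P$ iff both $A_1$ and $A_2$ have $P$; 6. there are $\epsilon\in(0,1)$ and $f:(0,\infty)\to(0,\infty)$ such that, for all $\delta>0$ and all $A$, if $\mathcal{Z}_\delta(1-\epsilon)A$ does not have $P$, then $I(A)\ge f(\delta)$; 7. there are real functions $g(\epsilon)>0$ and $h(\epsilon,\delta)$ of $\epsilon,\delta>0$, with $h(\epsilon,\delta)\to0$ as $\delta\to0$ for each fixed $\epsilon$, such that $I(A)\ge g(\epsilon)\,I(\mathcal{Z}_\delta(\epsilon)A)-h(\epsilon,\delta)R^d$ for all $\epsilon,\delta,R>0$ and all $A\subset Q(0,R)$. The property $P$ is *boundedly finite* if there is a family $\mathcal{P}$ of finite subsets of $\mathbb{R}^d$ with uniformly bounded diameters such that a measurable set $A$ has $P$ iff no member of $\mathcal{P}$ is a subset of $A$. **Theorem.** Let $P$ be a boundedly finite supersaturable property of measurable subsets of $\mathbb{R}^d$, and let $\Omega\subset\mathbb{R}^d$ be measurable. Then there is a measurable set $A\subset\Omega$ with property $P$ that is *locally optimal* for $P$ with respect to $\Omega$: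 for every bounded measurable set $S$ there is no measurable set $A'\subset\Omega$ with property $P$ such that $A\setminus S=A'\setminus S$ and $|A'\cap S|>|A\cap S|$. -/

import Mathlib

open MeasureTheory Filter Topology
open scoped ENNReal NNReal

namespace Supersat

/-- The space `ℝ^d` with its Euclidean distance and Lebesgue measure `volume`. -/
abbrev E (d : ℕ) : Type := EuclideanSpace ℝ (Fin d)

/-- Lebesgue measurable subsets of `ℝ^d` (measurable with respect to the completion of the
Borel `σ`-algebra). -/
def LMeas {d : ℕ} (A : Set (E d)) : Prop := NullMeasurableSet A volume

/-- `Q(x, r)`: the open axis-parallel cube of side length `r` centred at `x`. -/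
def cube {d : ℕ} (x : E d) (r : ℝ) : Set (E d) := {y | ∀ i, |y i - x i| < r / 2}

/-- The density of `A` on `D`, i.e. `|A ∩ D| / |D|`. -/
noncomputable def density {d : ℕ} (D A : Set (E d)) : ℝ≥0∞ := volume (A ∩ D) / volume D

/-- The upper limit density `limsup_{R → ∞} d_{Q(0,R)}(A)`. -/
noncomputable def upperDensity {d : ℕ} (A : Set (E d)) : ℝ≥0∞ :=
  limsup (fun R : ℝ => density (cube 0 R) A) atTop

/-- A property of measurable sets is given by a predicate on sets, of which only the values at
Lebesgue measurable sets are ever used. This is `m(P)`, the supremum of the upper densities of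
the measurable sets with property `P`. -/
noncomputable def maxDensity {d : ℕ} (P : Set (E d) → Prop) : ℝ≥0∞ :=
  ⨆ (A : Set (E d)) (_ : LMeas A) (_ : P A), upperDensity A

/-- The zooming-out operator `𝒵_δ(ε)`; its values are open sets. -/
def zoom {d : ℕ} (δ ε : ℝ) (A : Set (E d)) : Set (E d) :=
  {x | ENNReal.ofReal ε * volume (cube x δ) < volume (cube x δ ∩ A)}

/-- `I` is a saturation function for the property `P`. -/
structure IsSaturationFunction {d : ℕ} (P : Set (E d) → Prop) (I : Set (E d) → ℝ≥0∞) :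
    Prop where
  nontriviality : 0 < maxDensity P
  monotone_fun : ∀ A B : Set (E d), LMeas A → LMeas B → B ⊆ A → I B ≤ I A
  monotone_prop : ∀ A B : Set (E d), LMeas A → LMeas B → B ⊆ A → P A → P B
  positivity : ∀ A : Set (E d), LMeas A → 0 < I A → ¬ P A
  translation_fun : ∀ (A : Set (E d)) (x : E d), LMeas A → I ((fun y => y + x) '' A) = I A
  translation_prop : ∀ (A : Set (E d)) (x : E d), LMeas A → (P ((fun y => y + x) '' A) ↔ P A)
  locality : ∃ D : ℝ, ∀ A₁ A₂ : Set (E d), LMeas A₁ → LMeas A₂ →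
    (∀ x ∈ A₁, ∀ y ∈ A₂, D ≤ dist x y) →
      I A₁ + I A₂ ≤ I (A₁ ∪ A₂) ∧ (P (A₁ ∪ A₂) ↔ P A₁ ∧ P A₂)
  zoomability : ∃ ε : ℝ, 0 < ε ∧ ε < 1 ∧ ∃ f : ℝ → ℝ≥0, (∀ δ : ℝ, 0 < δ → 0 < f δ) ∧
    ∀ (δ : ℝ) (A : Set (E d)), 0 < δ → LMeas A → ¬ P (zoom δ (1 - ε) A) → (f δ : ℝ≥0∞) ≤ I A
  /-- The inequality `I(A) ≥ g(ε) I(𝒵_δ(ε)A) - h(ε,δ) R^d`, with the finite subtracted term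
  moved to the other side. (Replacing `h` by `max h 0` shows that asking for `h ≥ 0` is no
  restriction.) -/
  zooming_out : ∃ (g : ℝ → ℝ≥0) (h : ℝ → ℝ → ℝ≥0),
    (∀ ε : ℝ, 0 < ε → 0 < g ε) ∧
    (∀ ε : ℝ, 0 < ε → Tendsto (h ε) (𝓝[>] 0) (𝓝 0)) ∧
    ∀ (ε δ R : ℝ) (A : Set (E d)), 0 < ε → 0 < δ → 0 < R → LMeas A → A ⊆ cube 0 R →
      (g ε : ℝ≥0∞) * I (zoom δ ε A) ≤ I A + (h ε δ : ℝ≥0∞) * ENNReal.ofReal (R ^ d)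

/-- A property is supersaturable if it has a saturation function. -/
def Supersaturable {d : ℕ} (P : Set (E d) → Prop) : Prop :=
  ∃ I : Set (E d) → ℝ≥0∞, IsSaturationFunction P I

/-- A property is boundedly finite if it says that no member of some family of finite sets of
bounded diameter is contained in the set. -/
def BoundedlyFinite {d : ℕ} (P : Set (E d) → Prop) : Prop :=
  ∃ F : Set (Set (E d)), (∀ X ∈ F, X.Finite) ∧ (∃ r : ℝ, ∀ X ∈ F, Metric.diam X ≤ r) ∧
    ∀ A : Set (E d), LMeas A → (P A ↔ ∀ X ∈ F, ¬ X ⊆ A)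

/-- `A` is locally optimal for the property `P` with respect to `Ω`. -/
def LocallyOptimal {d : ℕ} (P : Set (E d) → Prop) (Ω A : Set (E d)) : Prop :=
  LMeas A ∧ A ⊆ Ω ∧ P A ∧
    ∀ S : Set (E d), LMeas S → Bornology.IsBounded S →
      ¬ ∃ A' : Set (E d), LMeas A' ∧ A' ⊆ Ω ∧ P A' ∧ A ∩ Sᶜ = A' ∩ Sᶜ ∧
        volume (A ∩ S) < volume (A' ∩ S)

end Supersat

namespace Supersat

/-! Take almost optimal sets `A n` in `Ω ∩ ball 0 n` and a weakly convergent subsequence with limit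
density `f`. Let `A₀` consist of the points of `Ω` where the support of `f` has density one; up to a
null set it is the support itself. Supersaturation gives `A₀` property `P`
(`exists_superset_of_density_points`). Near a forbidden configuration in `A₀` the set `{f > η}` is
so full that zoomability bounds `I` below by a constant on the zoomed-out `A n`. Zooming out at a
small enough scale then forces `I > 0` on a piece of `A n`, although that piece has `P`. For local
optimality, a better competitor `A'` is transplanted into `A n`, at the price of the part of `A n`
outside `A₀` in a bounded region. That part vanishes in the limit because `f = 0` a.e. off `A₀`.
Bounded finiteness keeps the transplant in `P`, and `f ≤ 1` a.e. turns the limiting inequality into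
a contradiction. -/

/-! ### Cubes and measurability of zooming out. -/

lemma cube_eq_preimage_ball {d : ℕ} (x : E d) {r : ℝ} (hr : 0 < r) :
    cube x r = (WithLp.ofLp : E d → Fin d → ℝ) ⁻¹' Metric.ball (WithLp.ofLp x) (r / 2) := by
  ext y
  simp [cube, dist_pi_lt_iff (half_pos hr), Real.dist_eq]

lemma isOpen_cube_pairs {d : ℕ} (r : ℝ) : IsOpen {p : E d × E d | p.2 ∈ cube p.1 r} := by
  have : {p : E d × E d | p.2 ∈ cube p.1 r} = ⋂ i, {p | |p.2 i - p.1 i| < r / 2} := by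
    ext p
    simp [cube]
  rw [this]
  exact isOpen_iInter_of_finite fun i => isOpen_lt (by fun_prop) (by fun_prop)

lemma isOpen_cube {d : ℕ} (x : E d) (r : ℝ) : IsOpen (cube x r) :=
  (isOpen_cube_pairs r).preimage (Continuous.prodMk_right x)

lemma isBounded_cube {d : ℕ} (x : E d) (r : ℝ) : Bornology.IsBounded (cube x r) := by
  have : Bornology.IsBounded ((WithLp.toLp 2) '' Metric.closedBall (WithLp.ofLp x) |r / 2|) :=
    ((isCompact_closedBall (WithLp.ofLp x) |r / 2|).image
      (PiLp.continuous_toLp 2 fun _ : Fin d => ℝ)).isBounded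
  refine this.subset fun y hy => ⟨WithLp.ofLp y, ?_, rfl⟩
  rw [Metric.mem_closedBall, dist_pi_le_iff (abs_nonneg _)]
  exact fun i => (hy i).le.trans (le_abs_self _)

lemma volume_cube_ne_top {d : ℕ} (x : E d) (r : ℝ) : volume (cube x r) ≠ ∞ :=
  (isBounded_cube x r).measure_lt_top.ne

lemma volume_cube_pos {d : ℕ} (x : E d) {r : ℝ} (hr : 0 < r) : 0 < volume (cube x r) :=
  (isOpen_cube x r).measure_pos _ ⟨x, fun i => by simpa using hr⟩

lemma ball_subset_cube {d : ℕ} (r : ℝ) : Metric.ball (0 : E d) r ⊆ cube 0 (2 * r) := by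
  intro x hx i
  have h := PiLp.norm_apply_le x i
  rw [mem_ball_zero_iff] at hx
  rw [Real.norm_eq_abs] at h
  simp only [PiLp.zero_apply, sub_zero]
  linarith

lemma cube_subset_cube {d : ℕ} {x : E d} {r s t : ℝ} (hx : x ∈ cube 0 s) (h : s + r ≤ t) :
    cube x r ⊆ cube 0 t := by
  intro y hy i
  have h1 := hx i
  have h2 := hy i
  simp only [PiLp.zero_apply, sub_zero] at h1 ⊢
  have := abs_add_le (y i - x i) (x i)
  rw [sub_add_cancel] at this
  linarith

lemma measurable_measure_cube {d : ℕ} (ρ : Measure (E d)) [SFinite ρ] (r : ℝ) :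
    Measurable fun x => ρ (cube x r) :=
  measurable_measure_prodMk_left (isOpen_cube_pairs r).measurableSet

lemma measurableSet_zoom {d : ℕ} (δ ε : ℝ) (A : Set (E d)) : MeasurableSet (zoom δ ε A) := by
  have h : zoom δ ε A =
      {x | ENNReal.ofReal ε * volume (cube x δ) < (volume.restrict A) (cube x δ)} := by
    ext x
    simp only [zoom, Set.mem_ofPred_eq, Measure.restrict_apply (isOpen_cube x δ).measurableSet]
  rw [h]
  exact measurableSet_lt ((measurable_measure_cube _ δ).const_mul _) (measurable_measure_cube _ δ)

/-! ### Differentiation along cubes. -/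

/-- Lebesgue differentiation of measures along open cubes. -/
theorem ae_tendsto_rnDeriv_cube {d : ℕ} (ρ : Measure (E d)) [IsLocallyFiniteMeasure ρ]
    (hρ : ρ ≪ volume) :
    ∀ᵐ x ∂(volume : Measure (E d)),
      Tendsto (fun r => ρ (cube x r) / volume (cube x r)) (𝓝[>] 0) (𝓝 (ρ.rnDeriv volume x)) := by
  -- Cubes are balls for the sup norm, so the Besicovitch theorem is applied on `Fin d → ℝ` and
  -- pulled back.
  have hvol := EuclideanSpace.volume_preserving_symm_measurableEquiv_toLp (Fin d)
  set e : E d ≃ᵐ (Fin d → ℝ) := (MeasurableEquiv.toLp 2 (Fin d → ℝ)).symm with he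
  have hcont : Continuous (WithLp.toLp 2 : (Fin d → ℝ) → E d) :=
    PiLp.continuous_toLp 2 fun _ : Fin d => ℝ
  have : IsLocallyFiniteMeasure (ρ.map e) := by
    refine ⟨fun y => ?_⟩
    obtain ⟨s, hs, hsρ⟩ := ρ.finiteAt_nhds (WithLp.toLp 2 y)
    refine ⟨e.symm ⁻¹' s, hcont.continuousAt hs, ?_⟩
    rwa [e.map_apply, ← Set.preimage_comp, e.symm_comp_self]
  have h := Besicovitch.ae_tendsto_rnDeriv (ρ.map e) (volume : Measure (Fin d → ℝ))
  rw [← hvol.map_eq] at h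
  have h2 := e.measurableEmbedding.rnDeriv_map ρ volume
  filter_upwards [ae_of_ae_map e.measurable.aemeasurable h, h2] with x hx hx2
  rw [← hx2]
  have hhalf : Tendsto (fun r : ℝ => r / 2) (𝓝[>] 0) (𝓝[>] 0) := by
    refine tendsto_nhdsWithin_iff.2 ⟨?_, ?_⟩
    · refine Tendsto.mono_left ?_ nhdsWithin_le_nhds
      have : ContinuousAt (fun r : ℝ => r / 2) 0 := by fun_prop
      simpa [ContinuousAt] using this
    · filter_upwards [self_mem_nhdsWithin] with r hr using half_pos (Set.mem_Ioi.1 hr)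
  refine (hx.comp hhalf).congr' ?_
  filter_upwards [self_mem_nhdsWithin] with r hr
  have hr : 0 < r := hr
  have hpre : e ⁻¹' Metric.ball (e x) (r / 2) = cube x r := (cube_eq_preimage_ball x hr).symm
  -- Besicovitch uses closed balls; the boundary sphere is null for volume, hence also for `ρ`.
  have hball : e ⁻¹' Metric.closedBall (e x) (r / 2) =ᵐ[volume] cube x r := by
    rw [← hpre]
    refine hvol.quasiMeasurePreserving.preimage_ae_eq ?_
    rw [← Metric.ball_union_sphere]
    refine union_ae_eq_left_of_ae_eq_empty (ae_eq_empty.2 ?_)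
    exact Measure.addHaar_sphere_of_ne_zero _ _ (half_pos hr).ne'
  rw [Function.comp_apply, e.map_apply, e.map_apply, measure_congr (hρ.ae_le hball),
    measure_congr hball]

/-! ### Weak compactness of sequences of sets. -/

/-- Indicators need not lie in `L²`, so they are multiplied by a positive weight `w ∈ L²`, which
bounds them there. If `g` is a weak limit, `g / w` is the desired density: testing against `1_S /
w`, which is in `L²` for bounded `S`, undoes the weight. -/
theorem exists_weak_limit_of_measurable {d : ℕ} (A : ℕ → Set (E d))
    (hA : ∀ n, MeasurableSet (A n)) :
    ∃ f : E d → ℝ≥0∞, Measurable f ∧ ∃ φ : ℕ → ℕ, StrictMono φ ∧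
      ∀ S : Set (E d), MeasurableSet S → Bornology.IsBounded S →
        Tendsto (fun n => volume (A (φ n) ∩ S)) atTop (𝓝 (∫⁻ x in S, f x)) := by
  -- An exponent beyond `d` makes `w` integrable; `w ≤ 1` then gives `w² ≤ w`, so `w ∈ L²`.
  set w : E d → ℝ := fun x => (1 + ‖x‖) ^ (-(d + 1 : ℝ)) with hw
  have hw_cont : Continuous w := by
    refine Continuous.rpow_const (by fun_prop) fun x => Or.inl ?_
    positivity
  have hw_pos : ∀ x, 0 < w x := fun x => by positivity
  have hw_le : ∀ x, w x ≤ 1 := fun x =>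
    Real.rpow_le_one_of_one_le_of_nonpos (by simp) (by linarith [d.cast_nonneg (α := ℝ)])
  have hw_int : Integrable w := integrable_one_add_norm (by simp)
  have hw_mem : MemLp w 2 volume := by
    rw [memLp_two_iff_integrable_sq hw_cont.aestronglyMeasurable]
    refine hw_int.mono (by fun_prop) (ae_of_all _ fun x => ?_)
    rw [Real.norm_of_nonneg (sq_nonneg _), Real.norm_of_nonneg (hw_pos x).le]
    nlinarith [hw_pos x, hw_le x]
  have hu_mem : ∀ n, MemLp ((A n).indicator w) 2 volume := fun n => hw_mem.indicator (hA n)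
  set u : ℕ → Lp ℝ 2 (volume : Measure (E d)) := fun n => (hu_mem n).toLp with hu
  have hu_norm : ∀ n, ‖u n‖ ≤ ‖hw_mem.toLp‖ := by
    intro n
    refine Lp.norm_le_norm_of_ae_le ?_
    filter_upwards [(hu_mem n).coeFn_toLp, hw_mem.coeFn_toLp] with x h1 h2
    rw [h1, h2]
    exact norm_indicator_le_norm_self w x
  have : Fact ((2 : ℝ≥0∞) ≠ ∞) := ⟨by simp⟩
  -- extract a weakly convergent subsequence
  have hseq := WeakDual.isSeqCompact_closedBall ℝ (Lp ℝ 2 (volume : Measure (E d))) 0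
    ‖hw_mem.toLp‖
  obtain ⟨G, -, φ, hφ, hG⟩ := hseq (x := fun n =>
    StrongDual.toWeakDual (InnerProductSpace.toDual ℝ _ (u n))) (fun n => by
      simpa using hu_norm n)
  obtain ⟨g, hg⟩ := (InnerProductSpace.toDual ℝ _).surjective (WeakDual.toStrongDual G)
  have hlim : ∀ v : Lp ℝ 2 (volume : Measure (E d)),
      Tendsto (fun n => inner ℝ (u (φ n)) v) atTop (𝓝 (inner ℝ g v)) := by
    intro v
    have h1 := ((WeakDual.eval_continuous v).tendsto G).comp hG
    have h2 : inner ℝ g v = G v := by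
      rw [← InnerProductSpace.toDual_apply_apply, hg]
      rfl
    rw [h2]
    exact h1
  -- Ensures that the `ENNReal.ofReal` in the limit density discards nothing.
  have hg_nonneg : 0 ≤ᵐ[volume] (g : E d → ℝ) := by
    have hg2 : ∀ s, MeasurableSet s → volume s < ∞ → IntegrableOn (g : E d → ℝ) s volume :=
      fun s _ hs => integrableOn_Lp_of_measure_ne_top g one_le_two hs.ne
    refine ae_nonneg_of_forall_setIntegral_nonneg_of_sigmaFinite hg2 fun s hs hsv => ?_
    rw [← L2.inner_indicatorConstLp_one hs hsv.ne, real_inner_comm]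
    refine ge_of_tendsto' (hlim _) fun n => ?_
    rw [real_inner_comm, L2.inner_indicatorConstLp_one hs hsv.ne]
    refine integral_nonneg_of_ae (ae_restrict_of_ae ?_)
    filter_upwards [(hu_mem (φ n)).coeFn_toLp] with x hx
    rw [hx]
    exact Set.indicator_nonneg (fun y _ => (hw_pos y).le) x
  refine ⟨fun x => ENNReal.ofReal (g x / w x), ?_, φ, hφ, fun S hS hb => ?_⟩
  · exact ((Lp.stronglyMeasurable g).measurable.div hw_cont.measurable).ennreal_ofReal
  obtain ⟨R, hR⟩ := hb.exists_norm_le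
  have hv_mem : MemLp (S.indicator fun x => (w x)⁻¹) 2 volume := by
    have : IsFiniteMeasure (volume.restrict S) := ⟨by simpa using hb.measure_lt_top⟩
    rw [memLp_indicator_iff_restrict hS]
    refine MemLp.of_bound (hw_cont.measurable.inv.aestronglyMeasurable)
      ((1 + R) ^ (d + 1 : ℝ)) ?_
    filter_upwards [ae_restrict_mem hS] with x hx
    rw [Real.norm_of_nonneg (inv_nonneg.2 (hw_pos x).le), hw]
    simp only
    rw [Real.rpow_neg (by positivity), inv_inv]
    have := hR x hx
    gcongr
  have hpair : ∀ v : Lp ℝ 2 (volume : Measure (E d)),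
      inner ℝ v hv_mem.toLp = ∫ x in S, v x / w x := by
    intro v
    rw [L2.inner_def, ← integral_indicator hS]
    refine integral_congr_ae ?_
    filter_upwards [hv_mem.coeFn_toLp] with x hx
    rw [hx]
    by_cases h : x ∈ S <;> simp [h, div_eq_mul_inv, mul_comm]
  have hint : IntegrableOn (fun x => g x / w x) S := by
    rw [← integrable_indicator_iff hS]
    refine (L2.integrable_inner (𝕜 := ℝ) g hv_mem.toLp).congr ?_
    filter_upwards [hv_mem.coeFn_toLp] with x hx
    rw [hx]
    by_cases h : x ∈ S <;> simp [h, div_eq_mul_inv, mul_comm]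
  have hlimit : ∫⁻ x in S, ENNReal.ofReal (g x / w x) =
      ENNReal.ofReal (inner ℝ g hv_mem.toLp) := by
    rw [hpair, ofReal_integral_eq_lintegral_ofReal hint]
    refine ae_restrict_of_ae ?_
    filter_upwards [hg_nonneg] with x hx using div_nonneg hx (hw_pos x).le
  rw [hlimit]
  refine ((ENNReal.continuous_ofReal.tendsto _).comp (hlim _)).congr fun n => ?_
  have hfin : volume (A (φ n) ∩ S) ≠ ∞ :=
    measure_ne_top_of_subset Set.inter_subset_right hb.measure_lt_top.ne
  have h1 : ∫ x in S, u (φ n) x / w x = volume.real (A (φ n) ∩ S) := by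
    have : ∀ᵐ x ∂volume.restrict S, u (φ n) x / w x = (A (φ n)).indicator 1 x := by
      refine ae_restrict_of_ae ?_
      filter_upwards [(hu_mem (φ n)).coeFn_toLp] with x hx
      rw [hx]
      by_cases h : x ∈ A (φ n) <;> simp [h, (hw_pos x).ne']
    rw [integral_congr_ae this, integral_indicator_one (hA _), measureReal_def,
      Measure.restrict_apply (hA _), measureReal_def]
  rw [Function.comp_apply, hpair, h1, ofReal_measureReal hfin]

theorem exists_weak_limit {d : ℕ} (A : ℕ → Set (E d)) (hA : ∀ n, LMeas (A n)) :
    ∃ f : E d → ℝ≥0∞, Measurable f ∧ ∃ φ : ℕ → ℕ, StrictMono φ ∧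
      ∀ S : Set (E d), LMeas S → Bornology.IsBounded S →
        Tendsto (fun n => volume (A (φ n) ∩ S)) atTop (𝓝 (∫⁻ x in S, f x)) := by
  choose A' hA' using fun n => (hA n)
  obtain ⟨f, hf, φ, hφ, h⟩ := exists_weak_limit_of_measurable A' fun n => (hA' n).1
  refine ⟨f, hf, φ, hφ, fun S hS hb => ?_⟩
  obtain ⟨T, hTS, hT, hTe⟩ := hS.exists_measurable_subset_ae_eq
  rw [← Measure.restrict_congr_set hTe]
  refine (h T hT (hb.subset hTS)).congr fun n => measure_congr ?_
  exact (hA' (φ n)).2.symm.inter hTe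

/-! ### Zoomed-out sets fill the support of the weak limit. -/

lemma tendsto_measure_diff_of_ae_eventually_mem {α ι : Type*} [MeasurableSpace α]
    {μ : Measure α} {G : Set α} (hμG : μ G ≠ ∞) {L : Filter ι} [L.IsCountablyGenerated]
    {T : ι → Set α} (hT : ∀ i, MeasurableSet (T i))
    (h : ∀ᵐ x ∂μ.restrict G, ∀ᶠ i in L, x ∈ T i) :
    Tendsto (fun i => μ (G \ T i)) L (𝓝 0) := by
  have : IsFiniteMeasure (μ.restrict G) := ⟨by simpa using hμG.lt_top⟩
  have := tendsto_measure_of_ae_tendsto_indicator_of_isFiniteMeasure L (μ := μ.restrict G)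
    (A := ∅) MeasurableSet.empty (fun i => (hT i).compl) (by
      filter_upwards [h] with x hx
      filter_upwards [hx] with i hi
      simpa using hi)
  rw [measure_empty] at this
  refine this.congr fun i => ?_
  rw [Measure.restrict_apply (hT i).compl, Set.inter_comm, Set.sdiff_eq]

/-- The sets `A n` converge weakly to the function `f`. -/
def WeakLimit {d : ℕ} (A : ℕ → Set (E d)) (f : E d → ℝ≥0∞) : Prop :=
  ∀ S : Set (E d), LMeas S → Bornology.IsBounded S →
    Tendsto (fun n => volume (A n ∩ S)) atTop (𝓝 (∫⁻ x in S, f x))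

lemma LMeas.of_measurableSet {d : ℕ} {S : Set (E d)} (hS : MeasurableSet S) : LMeas S :=
  MeasurableSet.nullMeasurableSet hS

lemma WeakLimit.lintegral_le {d : ℕ} {A : ℕ → Set (E d)} {f : E d → ℝ≥0∞} (h : WeakLimit A f)
    {S : Set (E d)} (hS : LMeas S) (hb : Bornology.IsBounded S) :
    ∫⁻ x in S, f x ≤ volume S :=
  le_of_tendsto' (h S hS hb) fun _ => measure_mono Set.inter_subset_right

lemma WeakLimit.isLocallyFiniteMeasure {d : ℕ} {A : ℕ → Set (E d)} {f : E d → ℝ≥0∞}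
    (h : WeakLimit A f) : IsLocallyFiniteMeasure (volume.withDensity f) := by
  refine ⟨fun x => ⟨Metric.ball x 1, Metric.ball_mem_nhds x one_pos, ?_⟩⟩
  rw [withDensity_apply _ measurableSet_ball]
  exact (h.lintegral_le (.of_measurableSet measurableSet_ball) Metric.isBounded_ball).trans_lt
    Metric.isBounded_ball.measure_lt_top

/-- Two limits in succession, each losing at most `τ / 2`. As `δ → 0`, the cube averages of `f`
exceed `η` at almost every point of `G`. For such a fixed `δ`, weak convergence on each cube passes
this to `A n` for large `n`; hence `n` depends on `δ`. -/
lemma WeakLimit.eventually_exists_volume_diff_zoom_le {d : ℕ} {A : ℕ → Set (E d)}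
    {f : E d → ℝ≥0∞} (h : WeakLimit A f) (hf : Measurable f) {η R : ℝ} {G : Set (E d)}
    (hG : MeasurableSet G) (hGR : G ⊆ cube 0 R) (hη : ∀ x ∈ G, ENNReal.ofReal η < f x)
    {τ : ℝ≥0∞} (hτ : 0 < τ) :
    ∀ᶠ δ in 𝓝[>] (0 : ℝ), ∃ n, volume (G \ zoom δ η (A n ∩ cube 0 (R + 1))) ≤ τ := by
  have := h.isLocallyFiniteMeasure
  set ν := volume.withDensity f with hν
  have hGfin : volume G ≠ ∞ := ((isBounded_cube 0 R).subset hGR).measure_lt_top.ne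
  set T : ℝ → Set (E d) := fun δ => {x | ENNReal.ofReal η * volume (cube x δ) < ν (cube x δ)}
    with hT
  have hTm : ∀ δ, MeasurableSet (T δ) := fun δ =>
    measurableSet_lt ((measurable_measure_cube _ δ).const_mul _) (measurable_measure_cube _ δ)
  have hGT : ∀ᵐ x ∂volume.restrict G, ∀ᶠ δ in 𝓝[>] (0 : ℝ), x ∈ T δ := by
    filter_upwards [ae_restrict_of_ae (ae_tendsto_rnDeriv_cube ν
      (withDensity_absolutelyContinuous _ _)), ae_restrict_mem hG,
      ae_restrict_of_ae (Measure.rnDeriv_withDensity volume hf)] with x hx hxG hxf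
    rw [hxf] at hx
    filter_upwards [hx.eventually_const_lt (hη x hxG), self_mem_nhdsWithin] with δ hδ hδ0
    exact (ENNReal.lt_div_iff_mul_lt (.inl (volume_cube_pos x hδ0).ne')
      (.inl (volume_cube_ne_top x δ))).1 hδ
  have hτ2 : 0 < τ / 2 := ENNReal.half_pos hτ.ne'
  filter_upwards [(tendsto_measure_diff_of_ae_eventually_mem hGfin hTm hGT).eventually_lt_const
    hτ2, self_mem_nhdsWithin, nhdsWithin_le_nhds (Iio_mem_nhds (one_pos (α := ℝ)))]
    with δ hδ hδ0 hδ1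
  have hzoom : ∀ᵐ x ∂volume.restrict (G ∩ T δ), ∀ᶠ n in atTop,
      x ∈ zoom δ η (A n ∩ cube 0 (R + 1)) := by
    filter_upwards [ae_restrict_mem (hG.inter (hTm δ))] with x hx
    have hlt : ENNReal.ofReal η * volume (cube x δ) < ∫⁻ y in cube x δ, f y := by
      rw [← withDensity_apply _ (isOpen_cube x δ).measurableSet]
      exact hx.2
    filter_upwards [(h (cube x δ) (.of_measurableSet (isOpen_cube x δ).measurableSet)
      (isBounded_cube x δ)).eventually_const_lt hlt] with n hn
    -- Since `δ < 1`, truncating `A n` to the cube of side `R + 1` loses nothing here.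
    have hsub : cube x δ ⊆ cube 0 (R + 1) :=
      cube_subset_cube (hGR hx.1) (by linarith [Set.mem_Iio.1 hδ1])
    change _ < volume (cube x δ ∩ (A n ∩ cube 0 (R + 1)))
    rwa [Set.inter_comm, Set.inter_assoc, Set.inter_eq_right.2 hsub]
  have hfin : volume (G ∩ T δ) ≠ ∞ := measure_ne_top_of_subset Set.inter_subset_left hGfin
  obtain ⟨n, hn⟩ := ((tendsto_measure_diff_of_ae_eventually_mem hfin
    (fun n => measurableSet_zoom _ _ _) hzoom).eventually_lt_const hτ2).exists
  refine ⟨n, ?_⟩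
  calc volume (G \ zoom δ η (A n ∩ cube 0 (R + 1)))
      ≤ volume ((G \ T δ) ∪ ((G ∩ T δ) \ zoom δ η (A n ∩ cube 0 (R + 1)))) := by
        refine measure_mono fun x hx => ?_
        by_cases hxT : x ∈ T δ
        · exact Or.inr ⟨⟨hx.1, hxT⟩, hx.2⟩
        · exact Or.inl ⟨hx.1, hxT⟩
    _ ≤ τ / 2 + τ / 2 := (measure_union_le _ _).trans (add_le_add hδ.le hn.le)
    _ = τ := ENNReal.add_halves τ

/-! ### Supersaturation excludes forbidden configurations. -/

/-- A finite configuration all of whose points are density points of the support of a weak limit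
of sets with property `P` cannot be forbidden. -/
theorem IsSaturationFunction.exists_superset_of_density_points {d : ℕ} {P : Set (E d) → Prop}
    {I : Set (E d) → ℝ≥0∞} (hI : IsSaturationFunction P I) {A : ℕ → Set (E d)}
    (hA : ∀ n, LMeas (A n)) (hP : ∀ n, P (A n)) {f : E d → ℝ≥0∞} (hf : Measurable f)
    (h : WeakLimit A f) {X : Set (E d)} (hX : X.Finite)
    (hd : ∀ x ∈ X, Tendsto (fun r => volume ({y | 0 < f y} ∩ cube x r) / volume (cube x r))
      (𝓝[>] 0) (𝓝 1)) :
    ∃ G, LMeas G ∧ X ⊆ G ∧ P G := by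
  by_contra! hforb
  obtain ⟨ε, hε0, hε1, c, hc, hzoomable⟩ := hI.zoomability
  obtain ⟨g, k, hg, hk, hout⟩ := hI.zooming_out
  -- the scale at which the support fills the cubes around the points of `X`
  obtain ⟨δ₀, hδ₀, hfill⟩ : ∃ δ₀ : ℝ, 0 < δ₀ ∧ ∀ x ∈ X,
      ENNReal.ofReal (1 - ε) * volume (cube x δ₀) < volume ({y | 0 < f y} ∩ cube x δ₀) := by
    have : ∀ᶠ r in 𝓝[>] (0 : ℝ), ∀ x ∈ X, ENNReal.ofReal (1 - ε) <
        volume ({y | 0 < f y} ∩ cube x r) / volume (cube x r) := by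
      refine (eventually_all_finite hX).2 fun x hx => (hd x hx).eventually_const_lt ?_
      rw [← ENNReal.ofReal_one]
      exact (ENNReal.ofReal_lt_ofReal_iff one_pos).2 (by linarith)
    obtain ⟨r, hr, hr0⟩ := (this.and self_mem_nhdsWithin).exists
    exact ⟨r, hr0, fun x hx => (ENNReal.lt_div_iff_mul_lt (.inl (volume_cube_pos x hr0).ne')
      (.inl (volume_cube_ne_top x r))).1 (hr x hx)⟩
  -- Zooming needs a positive threshold, so `{f > 0}` is exhausted by the sets `{f > 1 / (m + 1)}`;
  -- finiteness of `X` gives one `m` for all its points.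
  obtain ⟨m, hm⟩ : ∃ m : ℕ, ∀ x ∈ X, ENNReal.ofReal (1 - ε) * volume (cube x δ₀) <
      volume ({y | ENNReal.ofReal (1 / (m + 1)) < f y} ∩ cube x δ₀) := by
    have : ∀ᶠ m : ℕ in atTop, ∀ x ∈ X, ENNReal.ofReal (1 - ε) * volume (cube x δ₀) <
        volume ({y | ENNReal.ofReal (1 / (m + 1)) < f y} ∩ cube x δ₀) := by
      refine (eventually_all_finite hX).2 fun x hx => ?_
      have hmono : Monotone fun m : ℕ =>
          {y | ENNReal.ofReal (1 / (m + 1)) < f y} ∩ cube x δ₀ := by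
        intro a b hab y hy
        refine ⟨lt_of_le_of_lt (ENNReal.ofReal_le_ofReal ?_) hy.1, hy.2⟩
        exact one_div_le_one_div_of_le (by positivity) (by exact_mod_cast Nat.succ_le_succ hab)
      have hUnion : ⋃ m : ℕ, {y | ENNReal.ofReal (1 / (m + 1)) < f y} ∩ cube x δ₀ =
          {y | 0 < f y} ∩ cube x δ₀ := by
        rw [← Set.iUnion_inter]
        congr 1
        ext y
        simp only [Set.mem_iUnion, Set.mem_ofPred_eq]
        refine ⟨fun ⟨m, hm⟩ => hm.pos, fun hy => ?_⟩
        have ht : Tendsto (fun m : ℕ => ENNReal.ofReal (1 / (m + 1))) atTop (𝓝 0) := by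
          simpa [Function.comp_def] using (ENNReal.continuous_ofReal.tendsto 0).comp
            tendsto_one_div_add_atTop_nhds_zero_nat
        exact (ht.eventually_lt_const hy).exists
      have ht := tendsto_measure_iUnion_atTop (μ := volume) hmono
      rw [hUnion] at ht
      exact ht.eventually_const_lt (hfill x hx)
    exact this.exists
  set η : ℝ := 1 / (m + 1) with hη
  have hη0 : 0 < η := by positivity
  obtain ⟨R, hR0, hR⟩ : ∃ R : ℝ, 0 < R ∧ ∀ x ∈ X, cube x δ₀ ⊆ cube 0 R := by
    obtain ⟨C, hC⟩ := hX.isBounded.exists_norm_le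
    refine ⟨2 * (|C| + 1) + δ₀, by positivity, fun x hx =>
      cube_subset_cube (ball_subset_cube (|C| + 1) ?_) le_rfl⟩
    rw [mem_ball_zero_iff]
    linarith [hC x hx, le_abs_self C]
  set G := {y | ENNReal.ofReal η < f y} ∩ cube 0 R with hG
  have hGm : MeasurableSet G :=
    (measurableSet_lt measurable_const hf).inter (isOpen_cube 0 R).measurableSet
  have hGX : ∀ x ∈ X, ENNReal.ofReal (1 - ε) * volume (cube x δ₀) < volume (cube x δ₀ ∩ G) := by
    intro x hx
    have : cube x δ₀ ∩ G = {y | ENNReal.ofReal η < f y} ∩ cube x δ₀ := by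
      rw [hG, Set.inter_comm, Set.inter_assoc, Set.inter_eq_right.2 (hR x hx)]
    rw [this]
    exact hm x hx
  -- `τ` is a volume that `G` can lose while the cubes around `X` stay filled beyond the proportion
  -- `1 - ε`.
  obtain ⟨τ, hτ0, hτ⟩ : ∃ τ : ℝ≥0∞, 0 < τ ∧ ∀ x ∈ X,
      ENNReal.ofReal (1 - ε) * volume (cube x δ₀) + τ < volume (cube x δ₀ ∩ G) := by
    have : ∀ᶠ τ in 𝓝[>] (0 : ℝ≥0∞), ∀ x ∈ X,
        ENNReal.ofReal (1 - ε) * volume (cube x δ₀) + τ < volume (cube x δ₀ ∩ G) := by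
      refine (eventually_all_finite hX).2 fun x hx => nhdsWithin_le_nhds ?_
      have ht : Tendsto (fun τ => ENNReal.ofReal (1 - ε) * volume (cube x δ₀) + τ) (𝓝 0)
          (𝓝 (ENNReal.ofReal (1 - ε) * volume (cube x δ₀) + 0)) :=
        tendsto_const_nhds.add tendsto_id
      exact ht.eventually_lt_const (by simpa using hGX x hx)
    obtain ⟨τ, h1, h2⟩ := (this.and self_mem_nhdsWithin).exists
    exact ⟨τ, h2, h1⟩
  -- a scale at which zooming out costs little
  have hsmall : ∀ᶠ δ in 𝓝[>] (0 : ℝ),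
      (k η δ : ℝ≥0∞) * ENNReal.ofReal ((R + 1) ^ d) < (g η : ℝ≥0∞) * c δ₀ := by
    have ht : Tendsto (fun δ => (k η δ : ℝ≥0∞) * ENNReal.ofReal ((R + 1) ^ d)) (𝓝[>] 0)
        (𝓝 ((0 : ℝ≥0) * ENNReal.ofReal ((R + 1) ^ d))) :=
      ENNReal.Tendsto.mul_const (ENNReal.tendsto_coe.2 (hk η hη0)) (.inr ENNReal.ofReal_ne_top)
    refine ht.eventually_lt_const ?_
    rw [ENNReal.coe_zero, zero_mul]
    exact_mod_cast mul_pos (hg η hη0) (hc δ₀ hδ₀)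
  obtain ⟨δ, ⟨hδ, n, hn⟩, hδ0⟩ := ((hsmall.and (h.eventually_exists_volume_diff_zoom_le hf hGm
    Set.inter_subset_right (fun x hx => hx.1) hτ0)).and self_mem_nhdsWithin).exists
  set B := A n ∩ cube 0 (R + 1) with hB
  have hBm : LMeas B := NullMeasurableSet.inter (hA n)
    (isOpen_cube 0 (R + 1)).measurableSet.nullMeasurableSet
  have hBP : P B := hI.monotone_prop _ _ (hA n) hBm Set.inter_subset_left (hP n)
  have hIB : I B = 0 := by
    by_contra h0
    exact hI.positivity B hBm (pos_iff_ne_zero.2 h0) hBP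
  have hzm := measurableSet_zoom δ η B
  -- The bound depends on `δ₀` only, which was fixed before `δ`. It holds because zooming out `G ∩
  -- zoom δ η B` at scale `δ₀` still captures `X`, and `hforb` denies `P` to every measurable set
  -- containing `X`.
  have hlow : (c δ₀ : ℝ≥0∞) ≤ I (zoom δ η B) := by
    refine (hzoomable δ₀ (G ∩ zoom δ η B) hδ₀ (.of_measurableSet (hGm.inter hzm)) ?_).trans
      (hI.monotone_fun _ _ (.of_measurableSet hzm) (.of_measurableSet (hGm.inter hzm))
        Set.inter_subset_right)
    refine hforb _ (.of_measurableSet (measurableSet_zoom _ _ _)) fun x hx => ?_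
    change _ < volume (cube x δ₀ ∩ (G ∩ zoom δ η B))
    have hle : volume (cube x δ₀ ∩ G) ≤ volume (cube x δ₀ ∩ (G ∩ zoom δ η B)) + τ := by
      refine (measure_mono ?_).trans ((measure_union_le _ (G \ zoom δ η B)).trans
        (add_le_add le_rfl hn))
      intro y hy
      by_cases hyz : y ∈ zoom δ η B
      · exact Or.inl ⟨hy.1, hy.2, hyz⟩
      · exact Or.inr ⟨hy.2, hyz⟩
    exact lt_of_add_lt_add_right ((hτ x hx).trans_le hle)
  have hfinal := hout η δ (R + 1) B hη0 hδ0 (by linarith) hBm Set.inter_subset_right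
  rw [hIB, zero_add] at hfinal
  exact absurd (hfinal.trans_lt hδ) (not_lt.2 (mul_le_mul_right hlow _))

/-! ### The candidate set. -/

/-- The points of `Ω` at which the support of `f` has density `1` along cubes. -/
def densitySupport {d : ℕ} (Ω : Set (E d)) (f : E d → ℝ≥0∞) : Set (E d) :=
  {x ∈ Ω | Tendsto (fun r => volume ({y | 0 < f y} ∩ cube x r) / volume (cube x r))
    (𝓝[>] 0) (𝓝 1)}

/-- `P` may change when a null set is added, so the candidate is defined by a pointwise density
condition; the Lebesgue density theorem shows that this costs only a null set. -/
lemma densitySupport_ae_eq {d : ℕ} (Ω : Set (E d)) {f : E d → ℝ≥0∞} (hf : Measurable f) :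
    densitySupport Ω f =ᵐ[volume] ({y | 0 < f y} ∩ Ω : Set (E d)) := by
  have hm : MeasurableSet {y | 0 < f y} := measurableSet_lt measurable_const hf
  filter_upwards [ae_tendsto_rnDeriv_cube (volume.restrict {y | 0 < f y})
    Measure.absolutelyContinuous_restrict, Measure.rnDeriv_restrict_self volume hm] with x hx hxd
  rw [hxd] at hx
  have hx' : Tendsto (fun r => volume ({y | 0 < f y} ∩ cube x r) / volume (cube x r))
      (𝓝[>] 0) (𝓝 ({y | 0 < f y}.indicator 1 x)) := by
    refine hx.congr fun r => ?_
    rw [Measure.restrict_apply (isOpen_cube x r).measurableSet, Set.inter_comm]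
  refine propext (show x ∈ densitySupport Ω f ↔ x ∈ {y | 0 < f y} ∩ Ω from ?_)
  constructor
  · rintro ⟨hxΩ, h1⟩
    refine ⟨?_, hxΩ⟩
    by_contra hn
    rw [Set.indicator_of_notMem hn] at hx'
    exact zero_ne_one (tendsto_nhds_unique hx' h1)
  · rintro ⟨hpos, hxΩ⟩
    rw [Set.indicator_of_mem hpos] at hx'
    exact ⟨hxΩ, hx'⟩

lemma IsSaturationFunction.prop_empty {d : ℕ} {P : Set (E d) → Prop} {I : Set (E d) → ℝ≥0∞}
    (hI : IsSaturationFunction P I) : P ∅ := by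
  by_contra hne
  refine hI.nontriviality.ne' ?_
  simp only [maxDensity, ENNReal.iSup_eq_zero]
  exact fun A hA hP => absurd
    (hI.monotone_prop A ∅ hA MeasurableSet.empty.nullMeasurableSet (Set.empty_subset A) hP) hne

/-! ### Almost optimal sets and transplantation. -/

lemma exists_almost_optimal {d : ℕ} {P : Set (E d) → Prop} (hP : P ∅) (Ω : Set (E d)) {r : ℝ}
    {τ : ℝ≥0∞} (hτ : 0 < τ) :
    ∃ A, LMeas A ∧ A ⊆ Ω ∩ Metric.ball 0 r ∧ P A ∧
      ∀ B, LMeas B → B ⊆ Ω ∩ Metric.ball 0 r → P B → volume B ≤ volume A + τ := by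
  set 𝒜 := {A : Set (E d) | LMeas A ∧ A ⊆ Ω ∩ Metric.ball 0 r ∧ P A} with h𝒜
  have h0 : (∅ : Set (E d)) ∈ 𝒜 :=
    ⟨MeasurableSet.empty.nullMeasurableSet, Set.empty_subset _, hP⟩
  have hle : ∀ A ∈ 𝒜, volume A ≤ ⨆ B ∈ 𝒜, volume B := fun A hA =>
    le_iSup₂ (f := fun B (_ : B ∈ 𝒜) => volume B) A hA
  have hfin : ⨆ B ∈ 𝒜, volume B ≠ ∞ := by
    refine ne_top_of_le_ne_top (Metric.isBounded_ball (x := (0 : E d)) (r := r)).measure_lt_top.ne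
      (iSup₂_le fun B hB => measure_mono (hB.2.1.trans Set.inter_subset_right))
  by_cases hs : ⨆ B ∈ 𝒜, volume B = 0
  -- If the supremum is zero, truncated subtraction gives nothing strictly below it; the empty set
  -- is then optimal.
  · refine ⟨∅, h0.1, h0.2.1, h0.2.2, fun B h1 h2 h3 => ?_⟩
    have := hle B ⟨h1, h2, h3⟩
    rw [hs] at this
    exact this.trans zero_le
  · obtain ⟨A, hA, hAlt⟩ := (lt_biSup_iff).1 (ENNReal.sub_lt_self hfin hs hτ.ne')
    refine ⟨A, hA.1, hA.2.1, hA.2.2, fun B h1 h2 h3 => (hle B ⟨h1, h2, h3⟩).trans ?_⟩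
    exact tsub_le_iff_right.1 hAlt.le

/-- Inside a ball, replace `A` by a set `A'` that agrees with `A₀` outside the ball, after deleting
from `A` the points of a surrounding ball that are not in `A₀`. -/
def transplant {d : ℕ} (r s : ℝ) (A₀ A' A : Set (E d)) : Set (E d) :=
  (A' ∩ Metric.ball 0 r) ∪ (A \ (Metric.ball 0 r ∪ (Metric.ball 0 s \ A₀)))

lemma lmeas_transplant {d : ℕ} {r s : ℝ} {A₀ A' A : Set (E d)} (h₀ : LMeas A₀) (h' : LMeas A')
    (h : LMeas A) : LMeas (transplant r s A₀ A' A) :=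
  NullMeasurableSet.union (NullMeasurableSet.inter h' measurableSet_ball.nullMeasurableSet)
    (NullMeasurableSet.diff h (NullMeasurableSet.union measurableSet_ball.nullMeasurableSet
      (NullMeasurableSet.diff measurableSet_ball.nullMeasurableSet h₀)))

/-- If `X` meets the inner ball, it stays inside the outer one, where points of the transplant
outside the inner ball lie in `A₀` and so in `A'`. Otherwise `X` sees only points of `A`. Thus no
forbidden configuration straddles the interface. -/
lemma subset_or_subset_of_subset_transplant {d : ℕ} {r s : ℝ} {A₀ A' A X : Set (E d)}
    (hX : X.Finite) (hXs : r + Metric.diam X ≤ s)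
    (h₀ : A₀ ∩ (Metric.ball 0 r)ᶜ ⊆ A') (h : X ⊆ transplant r s A₀ A' A) : X ⊆ A' ∨ X ⊆ A := by
  by_cases hmeet : ∃ x ∈ X, x ∈ Metric.ball (0 : E d) r
  · obtain ⟨x, hx, hxr⟩ := hmeet
    refine Or.inl fun y hy => ?_
    rcases h hy with hy' | ⟨-, hy'⟩
    · exact hy'.1
    · rw [Set.mem_union, not_or] at hy'
      by_contra hyA
      refine hy'.2 ⟨?_, fun hy0 => hyA (h₀ ⟨hy0, hy'.1⟩)⟩
      rw [Metric.mem_ball] at hxr ⊢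
      have := Metric.dist_le_diam_of_mem hX.isBounded hy hx
      linarith [dist_triangle y x 0]
  · refine Or.inr fun y hy => ?_
    rcases h hy with hy' | hy'
    · exact absurd ⟨y, hy, hy'.2⟩ hmeet
    · exact hy'.1

/-- The part of `A` left untouched occurs on both sides and, having finite volume, cancels. -/
lemma volume_inter_ball_le_of_transplant {d : ℕ} {r s : ℝ} {A₀ A' A : Set (E d)} {τ : ℝ≥0∞}
    (h₀ : LMeas A₀) (hA : LMeas A) (hfin : volume A ≠ ∞)
    (h : volume (transplant r s A₀ A' A) ≤ volume A + τ) :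
    volume (A' ∩ Metric.ball 0 r) ≤
      volume (A ∩ Metric.ball 0 r) + volume (A ∩ (Metric.ball 0 s \ A₀)) + τ := by
  set K := Metric.ball (0 : E d) r
  set L := Metric.ball (0 : E d) s \ A₀
  have hL : LMeas L := NullMeasurableSet.diff measurableSet_ball.nullMeasurableSet h₀
  have hKL : LMeas (K ∪ L) :=
    NullMeasurableSet.union measurableSet_ball.nullMeasurableSet hL
  have h1 : volume (transplant r s A₀ A' A) = volume (A' ∩ K) + volume (A \ (K ∪ L)) := by
    refine measure_union₀ (NullMeasurableSet.diff hA hKL) ?_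
    refine Disjoint.aedisjoint (Set.disjoint_left.2 fun x hx hx' => hx'.2 (Or.inl hx.2))
  have h2 : volume A ≤ volume (A ∩ K) + volume (A ∩ L) + volume (A \ (K ∪ L)) := by
    rw [← measure_inter_add_sdiff₀ A hKL, Set.inter_union_distrib_left]
    gcongr
    exact measure_union_le _ _
  rw [h1] at h
  have h3 := h.trans (add_le_add_left h2 τ)
  have hfin' : volume (A \ (K ∪ L)) ≠ ∞ := measure_ne_top_of_subset Set.sdiff_subset hfin
  rw [add_right_comm] at h3
  exact (ENNReal.add_le_add_iff_right hfin').1 h3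

/-! ### Local optimality of the limit. -/

theorem exists_locallyOptimal {d : ℕ} {P : Set (E d) → Prop} (hfin : BoundedlyFinite P)
    (hsup : Supersaturable P) {Ω : Set (E d)} (hΩ : LMeas Ω) : ∃ A, LocallyOptimal P Ω A := by
  obtain ⟨F, hFfin, ⟨ρ, hρ⟩, hF⟩ := hfin
  obtain ⟨I, hI⟩ := hsup
  choose A hAm hAΩ hAP hAopt using fun n : ℕ => exists_almost_optimal hI.prop_empty Ω
    (r := n) (τ := ((n : ℝ≥0∞) + 1)⁻¹) (by simp)
  obtain ⟨f, hf, φ, hφ, hlim'⟩ := exists_weak_limit A hAm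
  have hlim : WeakLimit (fun n => A (φ n)) f := hlim'
  have hfm : MeasurableSet {y | 0 < f y} := measurableSet_lt measurable_const hf
  set A₀ := densitySupport Ω f with hA₀
  have hA₀e := densitySupport_ae_eq Ω hf
  have hA₀m : LMeas A₀ := (NullMeasurableSet.inter hfm.nullMeasurableSet hΩ).congr hA₀e.symm
  have hA₀P : P A₀ := by
    refine (hF A₀ hA₀m).2 fun X hX hXA => ?_
    obtain ⟨G, hG, hXG, hPG⟩ := hI.exists_superset_of_density_points (fun n => hAm (φ n))
      (fun n => hAP (φ n)) hf hlim (hFfin X hX) fun x hx => (hXA hx).2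
    exact (hF G hG).1 hPG X hX hXG
  -- Off `Ω` the integral vanishes since every `A n` lies in `Ω`; off the support it vanishes
  -- trivially.
  have hoff : ∀ S : Set (E d), LMeas S → Bornology.IsBounded S →
      ∫⁻ x in S \ A₀, f x = 0 := by
    intro S hS hb
    have h1 : LMeas (S \ Ω) := NullMeasurableSet.diff hS hΩ
    have h2 : ∫⁻ x in S \ Ω, f x = 0 := by
      refine tendsto_nhds_unique (hlim _ h1 (hb.subset Set.sdiff_subset)) ?_
      refine tendsto_const_nhds.congr fun n => ?_
      have : A (φ n) ∩ (S \ Ω) = ∅ := by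
        ext x
        simpa using fun hx _ => (hAΩ (φ n) hx).1
      rw [this, measure_empty]
    have h3 : ∫⁻ x in S \ {y | 0 < f y}, f x = 0 := by
      refine le_antisymm ((lintegral_mono_set fun x hx => hx.2).trans_eq
        (setLIntegral_eq_zero hfm.compl fun x hx => ?_)) zero_le
      simpa using hx
    have hae : (S \ A₀ : Set (E d)) =ᵐ[volume] (S \ {y | 0 < f y} ∪ S \ Ω : Set (E d)) := by
      rw [← Set.sdiff_inter]
      exact (ae_eq_refl S).diff hA₀e
    rw [setLIntegral_congr hae]
    exact le_antisymm ((lintegral_union_le _ _ _).trans (by rw [h2, h3, add_zero])) zero_le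
  refine ⟨A₀, hA₀m, fun x hx => hx.1, hA₀P, fun S hS hSb => ?_⟩
  rintro ⟨A', hA'm, hA'Ω, hA'P, hSA, hlt⟩
  obtain ⟨r, hr⟩ := hSb.subset_ball (0 : E d)
  set K := Metric.ball (0 : E d) r with hK
  set L := Metric.ball (0 : E d) (r + ρ) \ A₀ with hL
  have hKm : LMeas K := measurableSet_ball.nullMeasurableSet
  have hLm : LMeas L := NullMeasurableSet.diff measurableSet_ball.nullMeasurableSet hA₀m
  -- Once `φ n ≥ r`, the transplant fits in the ball of radius `φ n`, so it competes with `A (φ n)`.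
  -- The collar width `ρ` bounds the diameters of forbidden sets.
  have hcompare : ∀ᶠ n in atTop, volume (A' ∩ K) ≤
      volume (A (φ n) ∩ K) + volume (A (φ n) ∩ L) + ((φ n : ℝ≥0∞) + 1)⁻¹ := by
    filter_upwards [(tendsto_natCast_atTop_atTop.comp hφ.tendsto_atTop).eventually_ge_atTop r]
      with n hn
    refine volume_inter_ball_le_of_transplant hA₀m (hAm _) ?_ (hAopt _ _
      (lmeas_transplant hA₀m hA'm (hAm _)) ?_ ?_)
    · exact (measure_mono ((hAΩ _).trans Set.inter_subset_right)).trans_lt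
        Metric.isBounded_ball.measure_lt_top |>.ne
    · rintro x (hx | hx)
      · exact ⟨hA'Ω hx.1, Metric.ball_subset_ball hn hx.2⟩
      · exact hAΩ _ hx.1
    · refine (hF _ (lmeas_transplant hA₀m hA'm (hAm _))).2 fun X hX hXB => ?_
      rcases subset_or_subset_of_subset_transplant (hFfin X hX) (by linarith [hρ X hX])
        (fun x hx => (hSA.subset ⟨hx.1, fun hxS => hx.2 (hr hxS)⟩).1) hXB with h | h
      · exact (hF _ hA'm).1 hA'P X hX h
      · exact (hF _ (hAm _)).1 (hAP _) X hX h
  have htend : Tendsto (fun n => volume (A (φ n) ∩ K) + volume (A (φ n) ∩ L) +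
      ((φ n : ℝ≥0∞) + 1)⁻¹) atTop (𝓝 ((∫⁻ x in K, f x) + 0 + 0)) := by
    refine ((hlim K hKm Metric.isBounded_ball).add ?_).add ?_
    · rw [← hoff (Metric.ball 0 (r + ρ)) measurableSet_ball.nullMeasurableSet
        Metric.isBounded_ball]
      exact hlim L hLm (Metric.isBounded_ball.subset Set.sdiff_subset)
    · have h1 : Tendsto (fun n : ℕ => ((n : ℝ≥0∞) + 1)⁻¹) atTop (𝓝 0) :=
        tendsto_of_tendsto_of_tendsto_of_le_of_le tendsto_const_nhds
          ENNReal.tendsto_inv_nat_nhds_zero (fun _ => zero_le)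
          fun n => ENNReal.inv_le_inv.2 le_self_add
      exact h1.comp hφ.tendsto_atTop
  -- In the limit the collar term and the optimality defect disappear, and the integral of `f` over
  -- `A₀ ∩ K` is at most its volume.
  have hle : volume (A' ∩ K) ≤ volume (A₀ ∩ K) := by
    refine (ge_of_tendsto htend hcompare).trans ?_
    rw [add_zero, add_zero]
    have hKA : LMeas (A₀ ∩ K) := NullMeasurableSet.inter hA₀m hKm
    calc ∫⁻ x in K, f x = ∫⁻ x in A₀ ∩ K ∪ K \ A₀, f x := by
          rw [Set.inter_comm, Set.inter_union_sdiff]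
      _ ≤ (∫⁻ x in A₀ ∩ K, f x) + ∫⁻ x in K \ A₀, f x := lintegral_union_le _ _ _
      _ ≤ volume (A₀ ∩ K) := by
          rw [hoff K hKm Metric.isBounded_ball, add_zero]
          exact hlim.lintegral_le hKA (Metric.isBounded_ball.subset Set.inter_subset_right)
  have hsplit : ∀ B : Set (E d), volume (B ∩ K) = volume (B ∩ S) + volume (B ∩ Sᶜ ∩ K) := by
    intro B
    rw [← measure_inter_add_sdiff₀ (B ∩ K) hS]
    congr 2
    · rw [Set.inter_assoc, Set.inter_eq_right.2 hr]
    · ext x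
      simp only [Set.mem_sdiff, Set.mem_inter_iff, Set.mem_compl_iff]
      tauto
  rw [hsplit A', hsplit A₀, hSA] at hle
  have hfin : volume (A' ∩ Sᶜ ∩ K) ≠ ∞ :=
    measure_ne_top_of_subset Set.inter_subset_right Metric.isBounded_ball.measure_lt_top.ne
  exact hlt.not_ge ((ENNReal.add_le_add_iff_right hfin).1 hle)

end Supersat

theorem mainTheorem3 (d : ℕ) (P : Set (Supersat.E d) → Prop)
    (hfin : Supersat.BoundedlyFinite P) (hsup : Supersat.Supersaturable P)
    (Ω : Set (Supersat.E d)) (hΩ : Supersat.LMeas Ω) :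
    ∃ A : Set (Supersat.E d), Supersat.LocallyOptimal P Ω A :=
  Supersat.exists_locallyOptimal hfin hsup hΩ
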